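/- For an integer $N\ge 1$ and $\underline{\zeta}=(\zeta_1,\dots,\zeta_N)\in\mathbb{R}^N$, let $\lambda_N(\underline{\zeta})\in[0,\infty]$ be the supremum of the real $\lambda$ such that $$1\le |x|\le X,\qquad \max_{1\le j\le N}|\zeta_j x-y_j|\le X^{-\lambda}$$ has a solution $(x,y_1,\dots,y_N)\in\mathbb{Z}^{N+1}$ for arbitrarily large $X$. Let $w_N(\underline{\zeta})$, respectively $\widehat{w}_N(\underline{\zeta})$, in $[0,\infty]$ be the supremum of the real $w$ such that $$\max_{1\le j\le N}|x_j|\le X,\qquad |x_0+\zeta_1x_1+\cdots+\zeta_Nx_N|\le X^{-w}$$ has a solution $(x_0,\dots,x_N)\in\mathbb{Z}^{N+1}\setminus\{0\}$ for arbitrarily large $X$, respectively for all sufficiently large $X$. **Theorem.** Let $k\ge n\ge 1$ be integers with $k\ge 2$, let $\underline{\xi}=(\xi_1,\xi_2,\dots)$ be an infinite vector of real numbers, and for $N\ge1$ put $\underline{\xi}_N=(\xi_1,\dots,\xi_N)$. Assume that $1,\xi_1,\dots,\xi_k$ are linearly independent over $\mathbb{Q}$. Then $$\lambda_k(\underline{\xi}_k)\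 \ge\ \frac{(\widehat{w}_n(\underline{\xi}_n)-1)\,w_n(\underline{\xi}_n)}{\big((k-2)\widehat{w}_n(\underline{\xi}_n)+1\big)w_n(\underline{\xi}_n)+(k-1)\widehat{w}_n(\underline{\xi}_n)},$$ where for infinite exponents the right-hand side is read as its limit: if $w_n(\underline{\xi}_n)=\infty>\widehat{w}_n(\underline{\xi}_n)$ it is $\dfrac{\widehat{w}_n(\underline{\xi}_n)-1}{(k-2)\widehat{w}_n(\underline{\xi}_n)+1}$, and if $\widehat{w}_n(\underline{\xi}_n)=\infty$ (so that also $w_n(\underline{\xi}_n)=\infty$) it is $\dfrac1{k-2}$ for $k\ge3$ and $+\infty$ for $k=2$. -/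

import Mathlib

open Filter

/-- `X` admits a solution for the exponent `lam` of simultaneous approximation to `ξ`:
there are integers `x, y₁, …, y_N` with `1 ≤ |x| ≤ X` and `|ξ_j x - y_j| ≤ X ^ (-lam)` for all `j`. -/
def SimApproxSolvable {N : ℕ} (ξ : Fin N → ℝ) (lam X : ℝ) : Prop :=
  ∃ (x : ℤ) (y : Fin N → ℤ), 1 ≤ |x| ∧ ((|x| : ℤ) : ℝ) ≤ X ∧
    ∀ j, |ξ j * (x : ℝ) - (y j : ℝ)| ≤ X ^ (-lam)

/-- `X` admits a solution for the exponent `w` of linear form approximation to `ξ`: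
there is a nonzero integer vector `(x₀, x₁, …, x_N)` with `|x_j| ≤ X` for `1 ≤ j ≤ N` and
`|x₀ + ξ₁ x₁ + ⋯ + ξ_N x_N| ≤ X ^ (-w)`. -/
def LinFormSolvable {N : ℕ} (ξ : Fin N → ℝ) (w X : ℝ) : Prop :=
  ∃ (x₀ : ℤ) (x : Fin N → ℤ), (x₀ ≠ 0 ∨ x ≠ 0) ∧ (∀ j, ((|x j| : ℤ) : ℝ) ≤ X) ∧
    |(x₀ : ℝ) + ∑ j, ξ j * (x j : ℝ)| ≤ X ^ (-w)

/-- The ordinary exponent `λ_N(ξ)` of simultaneous approximation, possibly `+∞`. -/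
noncomputable def ordLambda {N : ℕ} (ξ : Fin N → ℝ) : EReal :=
  sSup ((fun lam : ℝ => (lam : EReal)) '' {lam | ∃ᶠ X in atTop, SimApproxSolvable ξ lam X})

/-- The ordinary exponent `w_N(ξ)` of linear form approximation, possibly `+∞`. -/
noncomputable def ordW {N : ℕ} (ξ : Fin N → ℝ) : EReal :=
  sSup ((fun w : ℝ => (w : EReal)) '' {w | ∃ᶠ X in atTop, LinFormSolvable ξ w X})

/-- The uniform exponent `ŵ_N(ξ)` of linear form approximation, possibly `+∞`. -/
noncomputable def unifW {N : ℕ} (ξ : Fin N → ℝ) : EReal :=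
  sSup ((fun w : ℝ => (w : EReal)) '' {w | ∀ᶠ X in atTop, LinFormSolvable ξ w X})

/-- The projection of an infinite real vector to its first `N` entries
(the entry `ξ_j` of the usual numbering `j = 1, 2, …` is `ξ (j - 1)` here). -/
def firstEntries (ξ : ℕ → ℝ) (N : ℕ) : Fin N → ℝ := fun j => ξ j

/-! Write `L(u) = u₀ + ∑ ξ_j u_j`. The exponent `w_n` supplies a primitive integer vector `u` with
`t = |L(u)|` small and coefficients at most `t^(-q)`, where `q` is near `1/w_n`. The uniform
exponent then supplies `v` with `|L(v)| ≤ t/2` and coefficients at most `(t/2)^(-p)`, where `p` is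
near `1/ŵ_n`. Since `u` is primitive and `0 < |L(v)| < |L(u)|`, the two are linearly independent.

Integer points `z` orthogonal to both `u` and `v` form a lattice of rank `k - 1` whose covolume is
controlled by the 2×2 minors of `(u, v)`. Minkowski's theorem yields such a `z ≠ 0` with `|z₀| ≪ Q`
and `|z_j - ξ_j z₀| ≪ δ` as soon as `t^(1-p) ≪ δ^(k-1)` and `t^(-p-q) ≪ Q δ^(k-2)`
(`exists_int_orthogonal`, `exists_int_approx`). Taking `δ = t^a`, `Q = t^(-b)` up to constants, and
`a`, `b` nearly extremal, gives `a/b` close to the stated bound (`frequently_simApproxSolvable`,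
`le_ordLambda`). -/

/-! ### Minkowski's theorem in the orthogonal complement of two integral forms. -/

open MeasureTheory in
/-- Minkowski's theorem on linear forms, with strict inequalities. -/
theorem exists_int_abs_mulVec_lt {ι : Type*} [Fintype ι] [DecidableEq ι] (M : Matrix ι ι ℝ)
    (h0 : M.det ≠ 0) (h1 : |M.det| < 1) :
    ∃ z : ι → ℤ, z ≠ 0 ∧ ∀ i, |M.mulVec (fun j => (z j : ℝ)) i| < 1 := by
  set s : Set (ι → ℝ) := (Matrix.toLin' M) ⁻¹' (Set.pi Set.univ fun _ => Set.Ioo (-1) 1) with hs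
  have hmem : ∀ x, x ∈ s ↔ ∀ i, |M.mulVec x i| < 1 := by
    intro x
    simp [hs, abs_lt, Set.mem_pi]
  have hdet : LinearMap.det (Matrix.toLin' M) = M.det := LinearMap.det_toLin' M
  have hconv : Convex ℝ s :=
    (convex_pi fun _ _ => convex_Ioo _ _).linear_preimage (Matrix.toLin' M)
  have hsymm : ∀ x ∈ s, -x ∈ s := by
    intro x hx
    rw [hmem] at hx ⊢
    intro i
    rw [Matrix.mulVec_neg, Pi.neg_apply, abs_neg]
    exact hx i
  -- The preimage of the cube `(-1, 1)^ι` has volume `2^card / |det M|`.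
  have hvol : volume (ZSpan.fundamentalDomain (Pi.basisFun ℝ ι)) *
      2 ^ Module.finrank ℝ (ι → ℝ) < volume s := by
    rw [hs, Measure.addHaar_preimage_linearMap volume (by rwa [hdet]), hdet,
      ZSpan.fundamentalDomain_pi_basisFun, Real.volume_pi_Ioo, Real.volume_pi_Ico]
    have h2 : (1 : ENNReal) < ENNReal.ofReal |M.det⁻¹| := by
      rw [← ENNReal.ofReal_one, ENNReal.ofReal_lt_ofReal_iff_of_nonneg zero_le_one, abs_inv]
      exact (one_lt_inv₀ (abs_pos.2 h0)).2 h1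
    have h3 : ENNReal.ofReal (1 - -1) = 2 := by norm_num
    simp only [sub_zero, ENNReal.ofReal_one, Finset.prod_const, h3, one_pow,
      Module.finrank_fintype_fun_eq_card, Finset.card_univ]
    exact ENNReal.mul_lt_mul_left (by simp) (by finiteness) h2
  have : Countable (Submodule.span ℤ (Set.range (Pi.basisFun ℝ ι))).toAddSubgroup :=
    inferInstanceAs (Countable (Submodule.span ℤ (Set.range (Pi.basisFun ℝ ι))))
  obtain ⟨x, hx0, hx⟩ := exists_ne_zero_mem_lattice_of_measure_mul_two_pow_lt_measure
    (ZSpan.isAddFundamentalDomain' (Pi.basisFun ℝ ι) volume) hsymm hconv hvol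
  have hxz := ((Pi.basisFun ℝ ι).mem_span_iff_repr_mem ℤ (x : ι → ℝ)).1 x.2
  choose z hz using hxz
  have hzx : (fun j => (z j : ℝ)) = x := by
    ext j
    simpa using hz j
  refine ⟨z, ?_, ?_⟩
  · rintro rfl
    apply hx0
    ext j
    rw [← hzx]
    simp
  · rw [hzx]
    exact (hmem _).1 hx

/-- Two rows inserted in the identity matrix at the places `a` and `b`. -/
noncomputable def insertRows {ι : Type*} [DecidableEq ι] (r₁ r₂ : ι → ℝ) (a b : ι) :
    Matrix ι ι ℝ :=
  1 + (Matrix.of ![Pi.single a (1 : ℝ), Pi.single b 1]).transpose *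
    Matrix.of ![r₁ - Pi.single a 1, r₂ - Pi.single b 1]

/-- The matrix is a rank-two perturbation of the identity, so `det (1 + AB) = det (1 + BA)` leaves a
2×2 determinant. -/
theorem det_insertRows {ι : Type*} [Fintype ι] [DecidableEq ι] (r₁ r₂ : ι → ℝ) {a b : ι}
    (hab : a ≠ b) : (insertRows r₁ r₂ a b).det = r₁ a * r₂ b - r₁ b * r₂ a := by
  rw [insertRows, Matrix.det_one_add_mul_comm, Matrix.det_fin_two]
  simp only [Matrix.add_apply, Matrix.one_apply_eq, Matrix.one_apply_ne zero_ne_one,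
    Matrix.one_apply_ne one_ne_zero, zero_add]
  change (1 + (r₁ - Pi.single a 1) ⬝ᵥ Pi.single a (1 : ℝ)) *
    (1 + (r₂ - Pi.single b 1) ⬝ᵥ Pi.single b (1 : ℝ)) -
    ((r₁ - Pi.single a 1) ⬝ᵥ Pi.single b (1 : ℝ)) *
    ((r₂ - Pi.single b 1) ⬝ᵥ Pi.single a (1 : ℝ)) = _
  simp [hab, hab.symm]

theorem insertRows_mulVec {ι : Type*} [Fintype ι] [DecidableEq ι] (r₁ r₂ s : ι → ℝ) (a b : ι)
    (i : ι) : (insertRows r₁ r₂ a b).mulVec s i =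
      s i + ((if i = a then r₁ ⬝ᵥ s - s a else 0) + if i = b then r₂ ⬝ᵥ s - s b else 0) := by
  rw [insertRows, Matrix.add_mulVec, ← Matrix.mulVec_mulVec, Matrix.one_mulVec, Pi.add_apply]
  congr 1
  rw [Matrix.mulVec, dotProduct, Fin.sum_univ_two]
  change (Pi.single a (1 : ℝ) : ι → ℝ) i * ((r₁ - Pi.single a 1) ⬝ᵥ s) +
    (Pi.single b (1 : ℝ) : ι → ℝ) i * ((r₂ - Pi.single b 1) ⬝ᵥ s) = _
  simp [sub_dotProduct, Pi.single_apply]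

theorem eq_zero_of_abs_lt_one_of_int {x : ℝ} {c : ℤ} (hc : x = c) (hx : |x| < 1) : x = 0 := by
  rw [hc] at hx ⊢
  have : |c| < 1 := by exact_mod_cast hx
  rw [Int.abs_lt_one_iff.1 this, Int.cast_zero]

/-- Small integer points in the orthogonal complement of two rows that are integral on the
lattice, measured in the coordinates given by the matrix `B`. -/
theorem exists_int_orthogonal {ι : Type*} [Fintype ι] [DecidableEq ι] (B : Matrix ι ι ℝ)
    (hB : B.det ≠ 0) (r₁ r₂ : ι → ℝ)
    (h₁ : ∀ z : ι → ℤ, ∃ c : ℤ, r₁ ⬝ᵥ B.mulVec (fun j => (z j : ℝ)) = c)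
    (h₂ : ∀ z : ι → ℤ, ∃ c : ℤ, r₂ ⬝ᵥ B.mulVec (fun j => (z j : ℝ)) = c)
    (hne : ∃ a b, r₁ a * r₂ b - r₁ b * r₂ a ≠ 0)
    (hlt : ∀ a b, |r₁ a * r₂ b - r₁ b * r₂ a| * |B.det| < 1) :
    ∃ z : ι → ℤ, z ≠ 0 ∧ ∀ i, |B.mulVec (fun j => (z j : ℝ)) i| ≤ Fintype.card ι := by
  obtain ⟨a₀, b₀, h0⟩ := hne
  have : Nonempty ι := ⟨a₀⟩
  -- The coordinates replaced by the two forms are those of a maximal minor, so that Cramer's rule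
  -- later recovers them with bounded coefficients.
  obtain ⟨⟨a, b⟩, hmax⟩ :=
    Finite.exists_max (fun x : ι × ι => |r₁ x.1 * r₂ x.2 - r₁ x.2 * r₂ x.1|)
  have hpos : 0 < |r₁ a * r₂ b - r₁ b * r₂ a| := (abs_pos.2 h0).trans_le (hmax (a₀, b₀))
  have hab : a ≠ b := by
    rintro rfl
    simp at hpos
  obtain ⟨z, hz0, hz⟩ := exists_int_abs_mulVec_lt (insertRows r₁ r₂ a b * B)
    (by rw [Matrix.det_mul, det_insertRows _ _ hab]; exact mul_ne_zero (abs_pos.1 hpos) hB)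
    (by rw [Matrix.det_mul, det_insertRows _ _ hab, abs_mul]; exact hlt a b)
  refine ⟨z, hz0, ?_⟩
  obtain ⟨c₁, hc₁⟩ := h₁ z
  obtain ⟨c₂, hc₂⟩ := h₂ z
  rw [← Matrix.mulVec_mulVec] at hz
  set s := B.mulVec (fun j => (z j : ℝ)) with hs
  simp only [insertRows_mulVec] at hz
  -- Both forms take integer values of modulus below 1, hence vanish.
  have e₁ : r₁ ⬝ᵥ s = 0 := eq_zero_of_abs_lt_one_of_int hc₁ (by simpa [hab] using hz a)
  have e₂ : r₂ ⬝ᵥ s = 0 := eq_zero_of_abs_lt_one_of_int hc₂ (by simpa [hab.symm] using hz b)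
  have hsmall : ∀ i, i ≠ a → i ≠ b → |s i| ≤ 1 := fun i ha hb => by
    simpa [ha, hb] using (hz i).le
  have key : ∀ a b, 0 < |r₁ a * r₂ b - r₁ b * r₂ a| →
      (∀ x : ι × ι, |r₁ x.1 * r₂ x.2 - r₁ x.2 * r₂ x.1| ≤ |r₁ a * r₂ b - r₁ b * r₂ a|) →
      (∀ i, i ≠ a → i ≠ b → |s i| ≤ 1) → |s a| ≤ Fintype.card ι := by
    intro a b hpos hmax hsmall
    -- Eliminating `s b` from the two relations leaves `s a` with the largest coefficient.
    have hsum : ∑ j, (r₁ j * r₂ b - r₁ b * r₂ j) * s j = 0 := by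
      have : ∑ j, (r₁ j * r₂ b - r₁ b * r₂ j) * s j = r₂ b * (r₁ ⬝ᵥ s) - r₁ b * (r₂ ⬝ᵥ s) := by
        simp only [dotProduct, Finset.mul_sum, ← Finset.sum_sub_distrib]
        exact Finset.sum_congr rfl fun j _ => by ring
      rw [this, e₁, e₂]
      ring
    rw [← Finset.add_sum_erase _ _ (Finset.mem_univ a)] at hsum
    have hle : |r₁ a * r₂ b - r₁ b * r₂ a| * |s a| ≤
        |r₁ a * r₂ b - r₁ b * r₂ a| * Fintype.card ι := by
      rw [← abs_mul, eq_neg_of_add_eq_zero_left hsum, abs_neg]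
      refine (Finset.abs_sum_le_sum_abs _ _).trans ?_
      refine (Finset.sum_le_card_nsmul _ _ |r₁ a * r₂ b - r₁ b * r₂ a| ?_).trans ?_
      · intro j hj
        by_cases hjb : j = b
        · subst hjb
          simp
        · rw [abs_mul]
          exact (mul_le_mul (hmax (j, b)) (hsmall j (Finset.ne_of_mem_erase hj) hjb)
            (abs_nonneg _) (abs_nonneg _)).trans (mul_one _).le
      · rw [nsmul_eq_mul, mul_comm]
        gcongr
        exact Finset.card_le_univ _
    exact le_of_mul_le_mul_left hle hpos
  have hcomm : |r₁ b * r₂ a - r₁ a * r₂ b| = |r₁ a * r₂ b - r₁ b * r₂ a| := abs_sub_comm _ _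
  intro i
  by_cases hia : i = a
  · exact hia ▸ key a b hpos hmax hsmall
  by_cases hib : i = b
  · exact hib ▸ key b a (by rwa [hcomm]) (by rwa [hcomm]) fun i h h' => hsmall i h' h
  · exact (hsmall i hia hib).trans (by exact_mod_cast Fintype.card_pos)

/-! ### Simultaneous approximations orthogonal to two linear forms. -/

/-- The value at `(1, ξ)` of the linear form with coefficients `u`. -/
noncomputable def linForm {k : ℕ} (ξ : Fin k → ℝ) (u : Fin (k + 1) → ℤ) : ℝ :=
  u 0 + ∑ j, ξ j * (u j.succ : ℝ)

/-- The matrix sending `z` to the scaled coordinates `z₀ / Q` and `(z_j - ξ_j z₀) / δ`. -/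
noncomputable def coordMatrix {k : ℕ} (ξ : Fin k → ℝ) (Q δ : ℝ) :
    Matrix (Fin (k + 1)) (Fin (k + 1)) ℝ :=
  Matrix.of (Fin.cons (Pi.single 0 Q⁻¹) fun i => Pi.single i.succ δ⁻¹ - Pi.single 0 (ξ i * δ⁻¹))

/-- The linear form with coefficients `u` in the coordinates of `coordMatrix`. -/
noncomputable def coordRow {k : ℕ} (ξ : Fin k → ℝ) (Q δ : ℝ) (u : Fin (k + 1) → ℤ) :
    Fin (k + 1) → ℝ :=
  Fin.cons (Q * linForm ξ u) fun j => δ * (u j.succ : ℝ)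

theorem coordMatrix_mulVec_zero {k : ℕ} (ξ : Fin k → ℝ) (Q δ : ℝ) (z : Fin (k + 1) → ℝ) :
    (coordMatrix ξ Q δ).mulVec z 0 = Q⁻¹ * z 0 := by
  simp [coordMatrix, Matrix.mulVec]

theorem coordMatrix_mulVec_succ {k : ℕ} (ξ : Fin k → ℝ) (Q δ : ℝ) (z : Fin (k + 1) → ℝ)
    (i : Fin k) : (coordMatrix ξ Q δ).mulVec z i.succ = δ⁻¹ * (z i.succ - ξ i * z 0) := by
  simp only [coordMatrix, Matrix.mulVec, Matrix.of_apply, Fin.cons_succ, sub_dotProduct,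
    single_dotProduct]
  ring

theorem det_coordMatrix {k : ℕ} (ξ : Fin k → ℝ) (Q δ : ℝ) :
    (coordMatrix ξ Q δ).det = Q⁻¹ * δ⁻¹ ^ k := by
  rw [Matrix.det_of_isLowerTriangular]
  · simp [coordMatrix, Fin.prod_univ_succ]
  · intro i j hij
    have hij' : i < j := hij
    induction i using Fin.cases with
    | zero => simp [coordMatrix, hij'.ne']
    | succ i => simp [coordMatrix, hij'.ne', ((Fin.zero_le _).trans_lt hij').ne']

/-- This is `u · z = L(u) z₀ + ∑ u_j (z_j - ξ_j z₀)`; it gives the integrality needed in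
`exists_int_orthogonal`. -/
theorem coordRow_dotProduct {k : ℕ} (ξ : Fin k → ℝ) {Q δ : ℝ} (hQ : Q ≠ 0) (hδ : δ ≠ 0)
    (u z : Fin (k + 1) → ℤ) :
    coordRow ξ Q δ u ⬝ᵥ (coordMatrix ξ Q δ).mulVec (fun j => (z j : ℝ)) =
      ((∑ j, u j * z j : ℤ) : ℝ) := by
  rw [dotProduct, Fin.sum_univ_succ, Fin.sum_univ_succ]
  simp only [coordMatrix_mulVec_zero, coordMatrix_mulVec_succ, coordRow, Fin.cons_zero,
    Fin.cons_succ, linForm]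
  push_cast
  have h0 : Q * (u 0 + ∑ j, ξ j * (u j.succ : ℝ)) * (Q⁻¹ * z 0) =
      u 0 * z 0 + ∑ j, ξ j * (u j.succ : ℝ) * z 0 := by
    rw [← Finset.sum_mul]
    field_simp
  rw [h0, add_assoc, ← Finset.sum_add_distrib]
  congr 1
  refine Finset.sum_congr rfl fun j _ => ?_
  field_simp
  ring

/-- With `k = r + 2`, the minors of the two rows are, up to sign, `Qδ (L(u) v_j - L(v) u_j)` and `δ²
(u_i v_j - u_j v_i)`; `hT` and `hD` keep them below `Q δ^k`, the inverse of the determinant of the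
coordinates. -/
theorem exists_int_approx {r : ℕ} (ξ : Fin (r + 2) → ℝ) {Q δ : ℝ} (hQ : 0 < Q) (hδ : 0 < δ)
    (hδ1 : (r + 3) * δ < 1) (u v : Fin (r + 2 + 1) → ℤ)
    (hne : ∃ j, linForm ξ u * v j ≠ linForm ξ v * u j)
    (hT : ∀ j : Fin (r + 2),
      |linForm ξ u * v j.succ - linForm ξ v * u j.succ| < δ ^ (r + 1))
    (hD : ∀ i j : Fin (r + 2),
      |(u i.succ : ℝ) * v j.succ - u j.succ * v i.succ| < Q * δ ^ r) :
    ∃ (x : ℤ) (y : Fin (r + 2) → ℤ), 1 ≤ |x| ∧ ((|x| : ℤ) : ℝ) ≤ (r + 3) * Q ∧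
      ∀ j, |ξ j * (x : ℝ) - (y j : ℝ)| ≤ (r + 3) * δ := by
  have hdet := det_coordMatrix ξ Q δ
  have hdet0 : 0 < Q⁻¹ * δ⁻¹ ^ (r + 2) := by positivity
  obtain ⟨z, hz0, hz⟩ := exists_int_orthogonal (coordMatrix ξ Q δ) (by rw [hdet]; exact hdet0.ne')
    (coordRow ξ Q δ u) (coordRow ξ Q δ v)
    (fun z => ⟨_, coordRow_dotProduct ξ hQ.ne' hδ.ne' u z⟩)
    (fun z => ⟨_, coordRow_dotProduct ξ hQ.ne' hδ.ne' v z⟩) (by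
      by_contra! hall
      -- The relations for `j ≥ 1`, weighted by `ξ_j` and summed, force the one for `j = 0`.
      have hs : ∀ j : Fin (r + 2), linForm ξ u * v j.succ = linForm ξ v * u j.succ := by
        intro j
        have h := hall 0 j.succ
        simp only [coordRow, Fin.cons_zero, Fin.cons_succ] at h
        have h' : (Q * δ) * (linForm ξ u * v j.succ - linForm ξ v * u j.succ) = 0 := by
          linear_combination h
        exact sub_eq_zero.1 ((mul_eq_zero.1 h').resolve_left (mul_pos hQ hδ).ne')
      obtain ⟨j, hj⟩ := hne
      refine hj ?_
      refine Fin.cases ?_ hs j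
      have hsum : linForm ξ u * ∑ j, ξ j * (v j.succ : ℝ) =
          linForm ξ v * ∑ j, ξ j * (u j.succ : ℝ) := by
        rw [Finset.mul_sum, Finset.mul_sum]
        exact Finset.sum_congr rfl fun j _ => by linear_combination ξ j * hs j
      have hu : linForm ξ u = u 0 + ∑ j, ξ j * (u j.succ : ℝ) := rfl
      have hv : linForm ξ v = v 0 + ∑ j, ξ j * (v j.succ : ℝ) := rfl
      linear_combination linForm ξ v * hu - linForm ξ u * hv - hsum) (by
      have hbound : Q * δ ^ (r + 2) * (Q⁻¹ * δ⁻¹ ^ (r + 2)) = 1 := by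
        rw [inv_pow]
        field_simp
      intro a b
      rw [hdet, abs_of_pos hdet0, ← hbound]
      refine mul_lt_mul_of_pos_right ?_ hdet0
      have h0 : ∀ j : Fin (r + 2), |Q * linForm ξ u * (δ * v j.succ) -
          δ * u j.succ * (Q * linForm ξ v)| < Q * δ ^ (r + 2) := by
        intro j
        have e : Q * linForm ξ u * (δ * v j.succ) - δ * u j.succ * (Q * linForm ξ v) =
            (Q * δ) * (linForm ξ u * v j.succ - linForm ξ v * u j.succ) := by ring
        rw [e, abs_mul, abs_of_pos (mul_pos hQ hδ), pow_succ', ← mul_assoc]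
        exact mul_lt_mul_of_pos_left (hT j) (mul_pos hQ hδ)
      induction a using Fin.cases with
      | zero =>
        induction b using Fin.cases with
        | zero =>
          simp only [sub_self, abs_zero]
          positivity
        | succ j => exact h0 j
      | succ i =>
        induction b using Fin.cases with
        | zero =>
          rw [abs_sub_comm]
          exact h0 i
        | succ j =>
          simp only [coordRow, Fin.cons_succ]
          have e : δ * (u i.succ : ℝ) * (δ * v j.succ) - δ * u j.succ * (δ * v i.succ) =
              δ ^ 2 * ((u i.succ : ℝ) * v j.succ - u j.succ * v i.succ) := by ring
          have e' : Q * δ ^ (r + 2) = δ ^ 2 * (Q * δ ^ r) := by ring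
          rw [e, e', abs_mul, abs_of_pos (pow_pos hδ 2)]
          exact mul_lt_mul_of_pos_left (hD i j) (pow_pos hδ 2))
  have hcard : ((Fintype.card (Fin (r + 2 + 1)) : ℕ) : ℝ) = r + 3 := by
    rw [Fintype.card_fin]
    push_cast
    ring
  rw [hcard] at hz
  have hsucc : ∀ j : Fin (r + 2), |ξ j * z 0 - z j.succ| ≤ (r + 3) * δ := by
    intro j
    have h := hz j.succ
    rwa [coordMatrix_mulVec_succ, abs_mul, abs_of_pos (inv_pos.2 hδ), inv_mul_le_iff₀ hδ,
      abs_sub_comm, mul_comm δ] at h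
  refine ⟨z 0, fun j => z j.succ, ?_, ?_, hsucc⟩
  -- If `z₀ = 0`, the other `z_j` are integers bounded by `(r + 3) δ < 1`, so `z = 0`.
  · by_contra hlt
    have hz00 : z 0 = 0 := Int.abs_lt_one_iff.1 (not_le.1 hlt)
    refine hz0 (funext fun j => ?_)
    refine Fin.cases hz00 (fun j => ?_) j
    have h := (hsucc j).trans_lt hδ1
    rw [hz00, Int.cast_zero, mul_zero, zero_sub, abs_neg] at h
    exact Int.abs_lt_one_iff.1 (by exact_mod_cast h)
  · have h := hz 0
    rw [coordMatrix_mulVec_zero, abs_mul, abs_of_pos (inv_pos.2 hQ), inv_mul_le_iff₀ hQ,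
      mul_comm Q] at h
    exact_mod_cast h

/-! ### Primitive linear forms and independence. -/

theorem linFormSolvable_iff {k : ℕ} {ξ : Fin k → ℝ} {w X : ℝ} :
    LinFormSolvable ξ w X ↔ ∃ u : Fin (k + 1) → ℤ, u ≠ 0 ∧
      (∀ j : Fin k, |(u j.succ : ℝ)| ≤ X) ∧ |linForm ξ u| ≤ X ^ (-w) := by
  constructor
  · rintro ⟨x₀, x, hne, hx, hL⟩
    refine ⟨Fin.cons x₀ x, ?_, ?_, ?_⟩
    · intro h0
      rcases hne with h | h
      · exact h (by simpa using congrFun h0 0)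
      · exact h (funext fun j => by simpa using congrFun h0 j.succ)
    · intro j
      simpa using hx j
    · simpa [linForm] using hL
  · rintro ⟨u, hne, hu, hL⟩
    refine ⟨u 0, fun j => u j.succ, ?_, ?_, hL⟩
    · by_contra! h
      exact hne (funext fun j => Fin.cases h.1 (fun j => congrFun h.2 j) j)
    · intro j
      simpa using hu j

theorem linForm_ne_zero {k : ℕ} {ξ : Fin k → ℝ}
    (hξ : LinearIndependent ℚ (Fin.cons 1 ξ : Fin (k + 1) → ℝ)) {u : Fin (k + 1) → ℤ}
    (hu : u ≠ 0) : linForm ξ u ≠ 0 := by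
  intro h0
  rw [Fintype.linearIndependent_iff] at hξ
  refine hu (funext fun j => ?_)
  have h := hξ (fun j => (u j : ℚ)) (by
    rw [Fin.sum_univ_succ, ← h0, linForm]
    simp [Rat.smul_def, mul_comm]) j
  exact_mod_cast h

theorem linForm_smul {k : ℕ} (ξ : Fin k → ℝ) (g : ℤ) (u : Fin (k + 1) → ℤ) :
    linForm ξ (fun j => g * u j) = g * linForm ξ u := by
  simp only [linForm, Int.cast_mul, mul_add, Finset.mul_sum]
  congr 1
  exact Finset.sum_congr rfl fun j _ => by ring

/-- A nonzero integer vector is a multiple of a primitive one. -/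
theorem exists_primitive {ι : Type*} [Fintype ι] {u : ι → ℤ} (hu : u ≠ 0) :
    ∃ (g : ℤ) (u' c : ι → ℤ), g ≠ 0 ∧ (u = fun j => g * u' j) ∧ ∑ j, c j * u' j = 1 := by
  obtain ⟨g, hg⟩ := (IsPrincipalIdealRing.principal (Ideal.span (Set.range u))).principal
  change Ideal.span (Set.range u) = Ideal.span {g} at hg
  have hdvd : ∀ j, g ∣ u j := fun j =>
    Ideal.mem_span_singleton.1 (hg ▸ Ideal.subset_span (Set.mem_range_self j))
  choose u' hu' using hdvd
  have hg0 : g ≠ 0 := by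
    rintro rfl
    exact hu (funext fun j => by simp [hu' j])
  have hmem : g ∈ Ideal.span (Set.range u) := hg ▸ Ideal.mem_span_singleton_self g
  obtain ⟨c, hc⟩ := Ideal.mem_span_range_iff_exists_fun.1 hmem
  refine ⟨g, u', c, hg0, funext hu', mul_left_cancel₀ hg0 ?_⟩
  rw [Finset.mul_sum, mul_one]
  exact (Finset.sum_congr rfl fun j _ => by rw [hu' j]; ring).trans hc

/-- Dividing by the gcd increases neither the coefficients nor the value. -/
theorem LinFormSolvable.exists_primitive {k : ℕ} {ξ : Fin k → ℝ} {w X : ℝ}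
    (h : LinFormSolvable ξ w X) : ∃ u c : Fin (k + 1) → ℤ, ∑ j, c j * u j = 1 ∧
      (∀ j : Fin k, |(u j.succ : ℝ)| ≤ X) ∧ |linForm ξ u| ≤ X ^ (-w) := by
  obtain ⟨u, hu0, hu, hL⟩ := linFormSolvable_iff.1 h
  obtain ⟨g, u', c, hg, rfl, hc⟩ := _root_.exists_primitive hu0
  have hg1 : (1 : ℝ) ≤ |(g : ℝ)| := by exact_mod_cast Int.one_le_abs hg
  refine ⟨u', c, hc, fun j => le_trans ?_ (hu j), le_trans ?_ hL⟩
  · push_cast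
    rw [abs_mul]
    exact le_mul_of_one_le_left (abs_nonneg _) hg1
  · rw [linForm_smul, abs_mul]
    exact le_mul_of_one_le_left (abs_nonneg _) hg1

/-- Otherwise, pairing with the Bézout vector `c` makes `L(v)` an integer multiple of `L(u)`; being
smaller, it is 0, against linear independence. -/
theorem exists_mul_ne_mul_of_primitive {k : ℕ} {ξ : Fin k → ℝ}
    (hξ : LinearIndependent ℚ (Fin.cons 1 ξ : Fin (k + 1) → ℝ)) {u v c : Fin (k + 1) → ℤ}
    (hc : ∑ j, c j * u j = 1) (hv : v ≠ 0) (hlt : |linForm ξ v| < |linForm ξ u|) :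
    ∃ j, linForm ξ u * v j ≠ linForm ξ v * u j := by
  by_contra! hall
  have hcR : ∑ j, (c j : ℝ) * u j = 1 := by exact_mod_cast hc
  have h : linForm ξ v = linForm ξ u * ((∑ j, c j * v j : ℤ) : ℝ) := by
    rw [← mul_one (linForm ξ v), ← hcR]
    push_cast
    rw [Finset.mul_sum, Finset.mul_sum]
    exact Finset.sum_congr rfl fun j _ => by linear_combination -(c j : ℝ) * hall j
  rw [h, abs_mul] at hlt
  have h1 : |((∑ j, c j * v j : ℤ) : ℝ)| < 1 := by
    by_contra! hge
    exact hlt.not_ge (le_mul_of_one_le_right (abs_nonneg _) hge)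
  rw [eq_zero_of_abs_lt_one_of_int rfl h1, mul_zero] at h
  exact linForm_ne_zero hξ hv h

/-! ### Choice of the convex body and the resulting approximations. -/

theorem eventually_rpow_lt {e c : ℝ} (he : 0 < e) (hc : 0 < c) :
    ∀ᶠ t : ℝ in nhdsWithin 0 (Set.Ioi 0), t ^ e < c := by
  have h : Tendsto (fun t : ℝ => t ^ e) (nhds 0) (nhds 0) := by
    simpa [Real.zero_rpow he.ne'] using (Real.continuousAt_rpow_const 0 e (Or.inr he.le)).tendsto
  exact (h.mono_left nhdsWithin_le_nhds).eventually_lt_const hc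

/-- The parameters of the convex body, compared with the sizes of the two linear forms. -/
theorem eventually_body_bounds (r : ℕ) {p q a b : ℝ} (h₁ : (r + 1) * a < 1 - p)
    (h₂ : p + q + r * a < b) :
    ∀ᶠ t : ℝ in nhdsWithin 0 (Set.Ioi 0),
      2 * (t * (t / 2) ^ (-p)) < (t ^ a / (r + 3)) ^ (r + 1) ∧
      2 * (t ^ (-q) * (t / 2) ^ (-p)) < t ^ (-b) / (r + 3) * (t ^ a / (r + 3)) ^ r := by
  have hc : 0 < (1 / (r + 3 : ℝ)) ^ (r + 1) / (2 * 2 ^ p) := by positivity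
  filter_upwards [eventually_rpow_lt (e := 1 - p - (r + 1) * a) (by linarith) hc,
    eventually_rpow_lt (e := b - p - q - r * a) (by linarith) hc, self_mem_nhdsWithin]
    with t h1 h2 ht
  have ht : 0 < t := ht
  have hdiv : (t / 2) ^ (-p) = t ^ (-p) * 2 ^ p := by
    rw [Real.div_rpow ht.le zero_le_two, Real.rpow_neg zero_le_two, div_inv_eq_mul]
  rw [lt_div_iff₀ (by positivity)] at h1 h2
  constructor
  · have e1 : t * t ^ (-p) = t ^ (1 - p - (r + 1) * a) * (t ^ a) ^ (r + 1) := by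
      rw [← Real.rpow_natCast (t ^ a), ← Real.rpow_mul ht.le, ← Real.rpow_add ht]
      nth_rewrite 1 [← Real.rpow_one t]
      rw [← Real.rpow_add ht]
      congr 1
      push_cast
      ring
    calc 2 * (t * (t / 2) ^ (-p))
        = t ^ (1 - p - (r + 1) * a) * (2 * 2 ^ p) * (t ^ a) ^ (r + 1) := by
          rw [hdiv]
          linear_combination 2 * 2 ^ p * e1
      _ < (1 / (r + 3 : ℝ)) ^ (r + 1) * (t ^ a) ^ (r + 1) :=
          mul_lt_mul_of_pos_right h1 (by positivity)
      _ = (t ^ a / (r + 3)) ^ (r + 1) := by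
          rw [← mul_pow]
          congr 1
          ring
  · have e2 : t ^ (-q) * t ^ (-p) = t ^ (b - p - q - r * a) * (t ^ (-b) * (t ^ a) ^ r) := by
      rw [← Real.rpow_natCast (t ^ a), ← Real.rpow_mul ht.le, ← Real.rpow_add ht,
        ← Real.rpow_add ht, ← Real.rpow_add ht]
      congr 1
      ring
    calc 2 * (t ^ (-q) * (t / 2) ^ (-p))
        = t ^ (b - p - q - r * a) * (2 * 2 ^ p) * (t ^ (-b) * (t ^ a) ^ r) := by
          rw [hdiv]
          linear_combination 2 * 2 ^ p * e2
      _ < (1 / (r + 3 : ℝ)) ^ (r + 1) * (t ^ (-b) * (t ^ a) ^ r) :=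
          mul_lt_mul_of_pos_right h2 (by positivity)
      _ = t ^ (-b) / (r + 3) * (t ^ a / (r + 3)) ^ r := by
          rw [div_pow (t ^ a), pow_succ, one_div, inv_pow]
          field_simp

theorem abs_mul_sub_mul_le {a b c d A B C D : ℝ} (ha : |a| ≤ A) (hb : |b| ≤ B) (hc : |c| ≤ C)
    (hd : |d| ≤ D) : |a * b - c * d| ≤ A * B + C * D := by
  refine (abs_sub _ _).trans ?_
  rw [abs_mul, abs_mul]
  exact add_le_add (mul_le_mul ha hb (abs_nonneg _) ((abs_nonneg _).trans ha))
    (mul_le_mul hc hd (abs_nonneg _) ((abs_nonneg _).trans hc))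

theorem frequently_simApproxSolvable {r : ℕ} {ξ : Fin (r + 2) → ℝ}
    (hξ : LinearIndependent ℚ (Fin.cons 1 ξ : Fin (r + 2 + 1) → ℝ)) {p q a b : ℝ}
    (hq : 0 < q) (hqp : q ≤ p) (ha : 0 < a) (hb : 0 < b)
    (h₁ : (r + 1) * a < 1 - p) (h₂ : p + q + r * a < b)
    (hU : ∀ᶠ X in atTop, LinFormSolvable ξ p⁻¹ X)
    (hW : ∃ᶠ X in atTop, LinFormSolvable ξ q⁻¹ X) :
    ∃ᶠ X in atTop, SimApproxSolvable ξ (a / b) X := by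
  have hp : 0 < p := hq.trans_le hqp
  rw [frequently_atTop]
  intro A
  have hhalf : Tendsto (fun t : ℝ => t / 2) (nhdsWithin 0 (Set.Ioi 0))
      (nhdsWithin 0 (Set.Ioi 0)) := by
    refine tendsto_nhdsWithin_iff.2 ⟨?_, ?_⟩
    · have : Tendsto (fun t : ℝ => t / 2) (nhds 0) (nhds (0 / 2)) := tendsto_id.div_const 2
      rw [zero_div] at this
      exact this.mono_left nhdsWithin_le_nhds
    · filter_upwards [self_mem_nhdsWithin] with t ht
      exact half_pos (Set.mem_Ioi.1 ht)
  have hev : ∀ᶠ t : ℝ in nhdsWithin 0 (Set.Ioi 0), t < 1 ∧ A ≤ t ^ (-b) ∧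
      LinFormSolvable ξ p⁻¹ ((t / 2) ^ (-p)) ∧
      (2 * (t * (t / 2) ^ (-p)) < (t ^ a / (r + 3)) ^ (r + 1) ∧
      2 * (t ^ (-q) * (t / 2) ^ (-p)) < t ^ (-b) / (r + 3) * (t ^ a / (r + 3)) ^ r) := by
    refine Eventually.and ?_ (Eventually.and ?_ (Eventually.and ?_ (eventually_body_bounds r h₁ h₂)))
    · exact nhdsWithin_le_nhds (eventually_lt_nhds zero_lt_one)
    · exact (tendsto_rpow_neg_nhdsGT_zero (neg_neg_of_pos hb)).eventually_ge_atTop A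
    · exact ((tendsto_rpow_neg_nhdsGT_zero (neg_neg_of_pos hp)).comp hhalf).eventually hU
  obtain ⟨ε, hε, hgood⟩ := mem_nhdsGT_iff_exists_Ioo_subset.1 hev
  have hsmall : ∀ᶠ X : ℝ in atTop, X ^ (-q⁻¹) < ε :=
    (tendsto_rpow_neg_atTop (inv_pos.2 hq)).eventually_lt_const hε
  obtain ⟨X, hX, hXε, hX0⟩ := (hW.and_eventually (hsmall.and (eventually_gt_atTop 0))).exists
  obtain ⟨u, c, hc, huX, hL⟩ := hX.exists_primitive
  have hu0 : u ≠ 0 := by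
    rintro rfl
    simp at hc
  set t := |linForm ξ u| with ht_def
  have ht : 0 < t := abs_pos.2 (linForm_ne_zero hξ hu0)
  obtain ⟨ht1, hA, hsolv, hb1, hb2⟩ := hgood ⟨ht, hL.trans_lt hXε⟩
  obtain ⟨v, hv0, hvY, hLv⟩ := linFormSolvable_iff.1 hsolv
  -- At this height the uniform exponent `p⁻¹` gives exactly `|L(v)| ≤ t / 2 < |L(u)|`.
  set Y := (t / 2) ^ (-p) with hY
  have hLv' : |linForm ξ v| ≤ t / 2 := by
    rwa [hY, ← Real.rpow_mul (half_pos ht).le, neg_mul_neg, mul_inv_cancel₀ hp.ne',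
      Real.rpow_one] at hLv
  have hXt : X ≤ t ^ (-q) := by
    have h := Real.rpow_le_rpow_of_nonpos ht hL (neg_nonpos.2 hq.le)
    rwa [← Real.rpow_mul hX0.le, neg_mul_neg, inv_mul_cancel₀ hq.ne', Real.rpow_one] at h
  -- Thanks to `q ≤ p`, both products in `L(u) v_j - L(v) u_j` are at most `t * Y`.
  have htY : t ^ (-q) ≤ Y :=
    (Real.rpow_le_rpow_of_exponent_ge ht ht1.le (neg_le_neg hqp)).trans
      (Real.rpow_le_rpow_of_nonpos (half_pos ht) (half_le_self ht.le)
        (neg_nonpos.2 hp.le))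
  have hr : (0 : ℝ) < r + 3 := by positivity
  have hta : 0 < t ^ a := Real.rpow_pos_of_pos ht a
  have htb : 0 < t ^ (-b) := Real.rpow_pos_of_pos ht _
  have huX' : ∀ j : Fin (r + 2), |(u j.succ : ℝ)| ≤ t ^ (-q) := fun j => (huX j).trans hXt
  obtain ⟨x, y, hx1, hx, hy⟩ := exists_int_approx ξ (div_pos htb hr) (div_pos hta hr)
    (by rw [mul_div_cancel₀ _ hr.ne']; exact Real.rpow_lt_one ht.le ht1 ha) u v
    (exists_mul_ne_mul_of_primitive hξ hc hv0 (hLv'.trans_lt (half_lt_self ht)))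
    (fun j => by
      refine ((abs_mul_sub_mul_le le_rfl (hvY j) hLv' ((huX' j).trans htY)).trans ?_).trans_lt hb1
      have : 0 ≤ t * Y := by positivity
      linarith)
    (fun i j => by
      refine ((abs_mul_sub_mul_le (huX' i) (hvY j) (huX' j) (hvY i)).trans ?_).trans_lt hb2
      linarith)
  refine ⟨t ^ (-b), hA, x, y, hx1, ?_, fun j => ?_⟩
  · rwa [mul_div_cancel₀ _ hr.ne'] at hx
  · have h := hy j
    rwa [mul_div_cancel₀ _ hr.ne', show a = -b * -(a / b) by field_simp,
      Real.rpow_mul ht.le] at h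

/-! ### From solvability to the exponents. -/

theorem LinFormSolvable.mono {N : ℕ} {ξ : Fin N → ℝ} {w w' X : ℝ} (h : LinFormSolvable ξ w X)
    (hw : w' ≤ w) (hX : 1 ≤ X) : LinFormSolvable ξ w' X := by
  obtain ⟨x₀, x, hne, hx, hL⟩ := h
  exact ⟨x₀, x, hne, hx, hL.trans (Real.rpow_le_rpow_of_exponent_le hX (neg_le_neg hw))⟩

/-- Padding by zeros turns forms in `n` variables into forms in `k` variables; `n` plays no further
role. -/
theorem LinFormSolvable.firstEntries_of_le {ξ : ℕ → ℝ} {n k : ℕ} (hnk : n ≤ k) {w X : ℝ}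
    (h : LinFormSolvable (firstEntries ξ n) w X) (hX : 0 ≤ X) :
    LinFormSolvable (firstEntries ξ k) w X := by
  obtain ⟨d, rfl⟩ := Nat.exists_eq_add_of_le hnk
  obtain ⟨x₀, x, hne, hx, hL⟩ := h
  have happ : x ≠ 0 → Fin.append x (0 : Fin d → ℤ) ≠ 0 := fun hx0 h0 =>
    hx0 (funext fun j => by simpa using congrFun h0 (Fin.castAdd d j))
  refine ⟨x₀, Fin.append x 0, hne.imp_right happ, fun j => ?_, ?_⟩
  · induction j using Fin.addCases with
    | left j => simpa using hx j
    | right j => simpa using hX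
  · rw [Fin.sum_univ_add]
    simpa [firstEntries] using hL

theorem eventually_linFormSolvable_of_lt_unifW {N : ℕ} {ξ : Fin N → ℝ} {w : ℝ}
    (h : (w : EReal) < unifW ξ) : ∀ᶠ X in atTop, LinFormSolvable ξ w X := by
  obtain ⟨_, ⟨v, hv, rfl⟩, hwv⟩ := lt_sSup_iff.1 h
  filter_upwards [hv, eventually_ge_atTop 1] with X hX hX1
  exact hX.mono (EReal.coe_lt_coe_iff.1 hwv).le hX1

theorem frequently_linFormSolvable_of_lt_ordW {N : ℕ} {ξ : Fin N → ℝ} {w : ℝ}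
    (h : (w : EReal) < ordW ξ) : ∃ᶠ X in atTop, LinFormSolvable ξ w X := by
  obtain ⟨_, ⟨v, hv, rfl⟩, hwv⟩ := lt_sSup_iff.1 h
  exact (Frequently.and_eventually hv (eventually_ge_atTop 1)).mono fun X hX =>
    hX.1.mono (EReal.coe_lt_coe_iff.1 hwv).le hX.2

theorem unifW_le_ordW {N : ℕ} (ξ : Fin N → ℝ) : unifW ξ ≤ ordW ξ :=
  sSup_le_sSup (Set.image_mono fun _ h => Eventually.frequently h)

theorem unifW_nonneg {N : ℕ} (ξ : Fin N → ℝ) : 0 ≤ unifW ξ := by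
  refine le_sSup ⟨0, ?_, EReal.coe_zero⟩
  filter_upwards [eventually_ge_atTop 0] with X hX
  exact ⟨1, 0, Or.inl one_ne_zero, fun j => by simpa using hX, by simp⟩

theorem ordLambda_nonneg {N : ℕ} (ξ : Fin N → ℝ) : 0 ≤ ordLambda ξ := by
  refine le_sSup ⟨0, Eventually.frequently ?_, EReal.coe_zero⟩
  filter_upwards [eventually_ge_atTop 1] with X hX
  refine ⟨1, fun j => ⌊ξ j⌋, by simp, by simpa using hX, fun j => ?_⟩
  rw [Int.cast_one, mul_one, neg_zero, Real.rpow_zero, Int.self_sub_floor, Int.abs_fract]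
  exact (Int.fract_lt_one _).le

/-- Lower bounds for `ordLambda` from parameters approaching the inverses `p` and `q` of the
uniform and the ordinary exponent. -/
theorem eventually_le_ordLambda {r : ℕ} {ξ : Fin (r + 2) → ℝ}
    (hξ : LinearIndependent ℚ (Fin.cons 1 ξ : Fin (r + 2 + 1) → ℝ)) {p q : ℝ}
    (hq : 0 ≤ q) (hqp : q ≤ p) (hp : p < 1)
    (hU : ∀ ε > 0, ∀ᶠ X in atTop, LinFormSolvable ξ (p + ε)⁻¹ X)
    (hW : ∀ ε > 0, ∃ᶠ X in atTop, LinFormSolvable ξ (q + ε)⁻¹ X) :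
    ∀ᶠ ε : ℝ in nhdsWithin 0 (Set.Ioi 0),
      (((1 - p - 2 * ε) / (r + 1) / (p + q + 3 * ε + r * ((1 - p - 2 * ε) / (r + 1))) : ℝ) :
        EReal) ≤ ordLambda ξ := by
  have hlt : ∀ᶠ ε : ℝ in nhdsWithin 0 (Set.Ioi 0), ε < (1 - p) / 2 :=
    nhdsWithin_le_nhds (eventually_lt_nhds (by linarith))
  filter_upwards [hlt, self_mem_nhdsWithin] with ε hε1 hε
  have hε : 0 < ε := hε
  have hr : (0 : ℝ) < r + 1 := by positivity
  have ha : 0 < (1 - p - 2 * ε) / (r + 1) := div_pos (by linarith) hr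
  -- With `p + ε` and `q + ε`, the slacks `2ε` in `a` and `3ε` in `b` make both inequalities strict.
  refine le_sSup ⟨_, frequently_simApproxSolvable hξ (add_pos_of_nonneg_of_pos hq hε)
    (add_le_add_left hqp ε) ha ?_ ?_ ?_ (hU ε hε) (hW ε hε), rfl⟩
  · have := hq.trans hqp
    positivity
  · rw [mul_div_cancel₀ _ hr.ne']
    linarith
  · linarith

/-- Let `ε → 0` in the preceding bound. `hpos` excludes only `r = p = q = 0`, where the bound tends
to infinity (`ordLambda_eq_top`). -/
theorem le_ordLambda {r : ℕ} {ξ : Fin (r + 2) → ℝ}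
    (hξ : LinearIndependent ℚ (Fin.cons 1 ξ : Fin (r + 2 + 1) → ℝ)) {p q : ℝ}
    (hq : 0 ≤ q) (hqp : q ≤ p) (hp : p < 1) (hpos : 0 < r + p + (r + 1) * q)
    (hU : ∀ ε > 0, ∀ᶠ X in atTop, LinFormSolvable ξ (p + ε)⁻¹ X)
    (hW : ∀ ε > 0, ∃ᶠ X in atTop, LinFormSolvable ξ (q + ε)⁻¹ X) :
    (((1 - p) / (r + p + (r + 1) * q) : ℝ) : EReal) ≤ ordLambda ξ := by
  have hr : (0 : ℝ) < r + 1 := by positivity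
  have hden : p + q + r * ((1 - p) / (r + 1)) = (r + p + (r + 1) * q) / (r + 1) := by
    field_simp
    ring
  have hden0 : p + q + 3 * 0 + r * ((1 - p - 2 * 0) / (r + 1)) ≠ 0 := by
    simp only [mul_zero, sub_zero, add_zero, hden]
    exact (div_pos hpos hr).ne'
  have hcont : ContinuousAt (fun ε : ℝ => (1 - p - 2 * ε) / (r + 1) /
      (p + q + 3 * ε + r * ((1 - p - 2 * ε) / (r + 1)))) 0 := by
    refine ContinuousAt.div ?_ ?_ hden0 <;> fun_prop
  have hval : (1 - p - 2 * 0) / (r + 1) / (p + q + 3 * 0 + r * ((1 - p - 2 * 0) / (r + 1))) =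
      (1 - p) / (r + p + (r + 1) * q) := by
    simp only [mul_zero, sub_zero, add_zero, hden]
    rw [div_div_div_cancel_right₀ hr.ne']
  rw [← hval]
  exact le_of_tendsto ((continuous_coe_real_ereal.tendsto _).comp
    (hcont.tendsto.mono_left nhdsWithin_le_nhds)) (eventually_le_ordLambda hξ hq hqp hp hU hW)

theorem ordLambda_eq_top {ξ : Fin 2 → ℝ}
    (hξ : LinearIndependent ℚ (Fin.cons 1 ξ : Fin 3 → ℝ))
    (hU : ∀ ε > 0, ∀ᶠ X in atTop, LinFormSolvable ξ ε⁻¹ X)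
    (hW : ∀ ε > 0, ∃ᶠ X in atTop, LinFormSolvable ξ ε⁻¹ X) :
    ordLambda ξ = ⊤ := by
  rw [EReal.eq_top_iff_forall_lt]
  intro y
  have hev := eventually_le_ordLambda (r := 0) (p := 0) (q := 0) hξ le_rfl le_rfl zero_lt_one
    (by simpa using hU) (by simpa using hW)
  have hlt : ∀ᶠ ε : ℝ in nhdsWithin 0 (Set.Ioi 0), ε < 1 / (3 * |y| + 3) :=
    nhdsWithin_le_nhds (eventually_lt_nhds (by positivity))
  obtain ⟨ε, hle, hlt, hε⟩ := (hev.and (hlt.and self_mem_nhdsWithin)).exists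
  have hε : 0 < ε := hε
  refine lt_of_lt_of_le (EReal.coe_lt_coe_iff.2 ?_) hle
  rw [lt_div_iff₀ (by positivity)] at hlt
  simp only [Nat.cast_zero, zero_add, sub_zero, div_one, zero_mul, add_zero]
  rw [lt_div_iff₀ (by positivity)]
  nlinarith [mul_le_mul_of_nonneg_right (le_abs_self y) hε.le]

theorem coe_inv_add_lt {w : EReal} {p ε : ℝ} (hε : 0 < ε)
    (h : w = ⊤ ∨ (0 < p ∧ w = (p⁻¹ : ℝ))) : (((p + ε)⁻¹ : ℝ) : EReal) < w := by
  rcases h with rfl | ⟨hp, rfl⟩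
  · exact EReal.coe_lt_top _
  · exact EReal.coe_lt_coe_iff.2 (inv_strictAnti₀ hp (lt_add_of_pos_right p hε))

theorem mainTheorem10 (k n : ℕ) (hn : 1 ≤ n) (hnk : n ≤ k) (hk : 2 ≤ k) (ξ : ℕ → ℝ)
    (hξ : LinearIndependent ℚ (Fin.cons 1 (firstEntries ξ k) : Fin (k + 1) → ℝ)) :
    -- both exponents finite
    (∀ w w' : ℝ, ordW (firstEntries ξ n) = w → unifW (firstEntries ξ n) = w' →
      ((((w' - 1) * w) / ((((k : ℝ) - 2) * w' + 1) * w + ((k : ℝ) - 1) * w') : ℝ) : EReal)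
        ≤ ordLambda (firstEntries ξ k)) ∧
    -- infinite ordinary exponent, finite uniform exponent
    (∀ w' : ℝ, ordW (firstEntries ξ n) = ⊤ → unifW (firstEntries ξ n) = w' →
      (((w' - 1) / (((k : ℝ) - 2) * w' + 1) : ℝ) : EReal) ≤ ordLambda (firstEntries ξ k)) ∧
    -- infinite uniform exponent
    (unifW (firstEntries ξ n) = ⊤ →
      (k = 2 → ordLambda (firstEntries ξ k) = ⊤) ∧
      (3 ≤ k → ((1 / ((k : ℝ) - 2) : ℝ) : EReal) ≤ ordLambda (firstEntries ξ k))) := by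
  have hU : ∀ p : ℝ, (unifW (firstEntries ξ n) = ⊤ ∨
      (0 < p ∧ unifW (firstEntries ξ n) = (p⁻¹ : ℝ))) →
      ∀ ε > 0, ∀ᶠ X in atTop, LinFormSolvable (firstEntries ξ k) (p + ε)⁻¹ X := by
    intro p h ε hε
    filter_upwards [eventually_linFormSolvable_of_lt_unifW (coe_inv_add_lt hε h),
      eventually_ge_atTop 0] with X hX hX0
    exact hX.firstEntries_of_le hnk hX0
  have hW : ∀ q : ℝ, (ordW (firstEntries ξ n) = ⊤ ∨
      (0 < q ∧ ordW (firstEntries ξ n) = (q⁻¹ : ℝ))) →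
      ∀ ε > 0, ∃ᶠ X in atTop, LinFormSolvable (firstEntries ξ k) (q + ε)⁻¹ X := by
    intro q h ε hε
    exact ((frequently_linFormSolvable_of_lt_ordW (coe_inv_add_lt hε h)).and_eventually
      (eventually_ge_atTop 0)).mono fun X hX => hX.1.firstEntries_of_le hnk hX.2
  have hle := unifW_le_ordW (firstEntries ξ n)
  have h0 := unifW_nonneg (firstEntries ξ n)
  obtain ⟨r, rfl⟩ := Nat.exists_eq_add_of_le' hk
  have hr : (0 : ℝ) ≤ r := Nat.cast_nonneg r
  have hk2 : ((r + 2 : ℕ) : ℝ) - 2 = r := by push_cast; ring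
  have hk1 : ((r + 2 : ℕ) : ℝ) - 1 = r + 1 := by push_cast; ring
  rw [hk2, hk1]
  refine ⟨fun w w' hw hw' => ?_, fun w' hw hw' => ?_, fun hw' => ⟨fun h2 => ?_, fun h3 => ?_⟩⟩
  · rw [hw, hw', EReal.coe_le_coe_iff] at hle
    rw [hw', EReal.coe_nonneg] at h0
    -- For `w' ≤ 1` the bound is nonpositive; otherwise `p = 1/w' < 1`, as the construction
    -- requires.
    rcases le_or_gt w' 1 with h1 | h1
    · refine le_trans (EReal.coe_nonpos.2 ?_) (ordLambda_nonneg _)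
      have hw0 := h0.trans hle
      exact div_nonpos_of_nonpos_of_nonneg
        (mul_nonpos_of_nonpos_of_nonneg (sub_nonpos.2 h1) hw0) (by positivity)
    · have hw'0 : 0 < w' := zero_lt_one.trans h1
      have hw0 : 0 < w := hw'0.trans_le hle
      have h := le_ordLambda hξ (p := w'⁻¹) (q := w⁻¹) (by positivity) (inv_anti₀ hw'0 hle)
        (inv_lt_one_of_one_lt₀ h1) (by positivity)
        (hU _ (Or.inr ⟨by positivity, by rw [inv_inv, hw']⟩))
        (hW _ (Or.inr ⟨by positivity, by rw [inv_inv, hw]⟩))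
      convert h using 2
      field_simp
  · rw [hw', EReal.coe_nonneg] at h0
    rcases le_or_gt w' 1 with h1 | h1
    · refine le_trans (EReal.coe_nonpos.2 ?_) (ordLambda_nonneg _)
      exact div_nonpos_of_nonpos_of_nonneg (sub_nonpos.2 h1) (by positivity)
    · have hw'0 : 0 < w' := zero_lt_one.trans h1
      have h := le_ordLambda hξ (p := w'⁻¹) (q := 0) le_rfl (by positivity)
        (inv_lt_one_of_one_lt₀ h1) (by positivity)
        (hU _ (Or.inr ⟨by positivity, by rw [inv_inv, hw']⟩))
        (hW _ (Or.inl hw))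
      convert h using 2
      field_simp
      ring
  · obtain rfl : r = 0 := by omega
    rw [hw', top_le_iff] at hle
    exact ordLambda_eq_top hξ (by simpa using hU 0 (Or.inl hw'))
      (by simpa using hW 0 (Or.inl hle))
  · rw [hw', top_le_iff] at hle
    have hr1 : (0 : ℝ) < r := by exact_mod_cast (show 0 < r by omega)
    have h := le_ordLambda hξ (p := 0) (q := 0) le_rfl le_rfl zero_lt_one (by simpa using hr1)
      (hU 0 (Or.inl hw')) (hW 0 (Or.inl hle))
    simpa using h
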